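/- Maximum coverage: given sets $S_1,\dots,S_m\subseteq[n]$ and $k\ge 1$, find $k$ of the sets covering as many elements as possible; let $\mathrm{Opt}$ be the maximum number of elements covered by $k$ sets, and let $f\ge 1$ be the maximum frequency, i.e. the maximum over elements of $[n]$ of the number of sets containing that element. Assume $1\le k\le m\le n$ (no assumption $k=\Omega(m)$ is made). MPC model: there are $m$ machines; machine $j$ initially holds the characteristic vector of $S_j$, and one machine is designated as central. The computation proceeds in synchronous rounds. In each round every machine performs an arbitrary local computation on its memory, the messages it received in the previous round and fresh private random bits, and then sends messages to the other machines; the memory of a machine and the total size of the messages it receives in a round are at most $\tilde O(n)=O(n(1+\log n)^{O(1)})$ bits. After the last round the central machine outputs the solution. The algorithm knows $n,m,k,f,\varepsilon$. Claim. Let $c\in\mathbb N$. With constants depending only on $c$, the following holds for all $n,m,k,f$ as above and all $0<\varepsilon<1-1/e$. There is a randomized MPC algorithm with $$O\!\left(\frac{f^3}{\varepsilon^6}\,\log^2\frac{kf}{\varepsilon}\right)$$ rounds and $\tilde O(n)$ memory per machine (the hidden constants do not depend on $\varepsilon$) such that, for every instance with maximum frequency $f$: (i) the algorithm first restricts to the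 $\lceil kf/\varepsilon\rceil$ largest sets (to all sets if $m\le\lceil kf/\varepsilon\rceil$), i.e. after $O(1)$ rounds only the machines holding these sets and the central machine exchange messages, and the output consists of $k$ of these sets; and (ii) with probability at least $1-1/m^{c}$ the $k$ output sets cover at least $(1-1/e-\varepsilon)\,\mathrm{Opt}$ elements. -/

import Mathlib

/-! ### Maximum coverage -/

/-- Number of elements covered by the sub-collection `T` of the sets `S 0, …, S (m-1) ⊆ [n]`. -/
def coverage {n m : ℕ} (S : Fin m → Finset (Fin n)) (T : Finset (Fin m)) : ℕ :=
  (T.biUnion S).card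

/-- `Opt`: the largest number of elements covered by `k` of the sets. -/
def optCoverage {n m : ℕ} (S : Fin m → Finset (Fin n)) (k : ℕ) : ℕ :=
  (Finset.powersetCard k (Finset.univ : Finset (Fin m))).sup (coverage S)

/-- The frequency of the element `i`: the number of sets that contain it. -/
def frequency {n m : ℕ} (S : Fin m → Finset (Fin n)) (i : Fin n) : ℕ :=
  (Finset.univ.filter fun j => i ∈ S j).card

/-- The maximum frequency of an element. -/
def maxFrequency {n m : ℕ} (S : Fin m → Finset (Fin n)) : ℕ :=
  Finset.univ.sup (frequency S)

/-- `L` consists of the `N` largest of the sets (of all sets, if there are at most `N`), ties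
being broken in some way. -/
def IsLargest {n m : ℕ} (S : Fin m → Finset (Fin n)) (N : ℕ) (L : Finset (Fin m)) : Prop :=
  L.card = min N m ∧ ∀ i ∈ L, ∀ j ∉ L, (S j).card ≤ (S i).card

/-! ### Massively parallel computation -/

/-- A randomized MPC algorithm on `m` machines that outputs a set of machine indices.
In round `t`, machine `j` applies `step t j` to the content of its memory, to the messages that it
received in the previous round (one bit string from each machine), and to fresh private random
bits; the result is the new content of its memory and the message for each machine.
After the last round the central machine computes the output from its memory and from the
messages it received in the last round. Local computation is free. -/
structure MPCAlgorithm (m : ℕ) where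
  rounds : ℕ
  coins : ℕ
  central : Fin m
  step : ℕ → Fin m → List Bool → (Fin m → List Bool) → (Fin coins → Bool) →
    List Bool × (Fin m → List Bool)
  output : List Bool → (Fin m → List Bool) → Finset (Fin m)

/-- A global configuration: `mem j` is the memory of machine `j`, and `inbox j i` is the message
that `j` received from `i` in the latest round. -/
structure MPCConfig (m : ℕ) where
  mem : Fin m → List Bool
  inbox : Fin m → Fin m → List Bool

namespace MPCAlgorithm

variable {m : ℕ} (A : MPCAlgorithm m)

/-- The outcomes of the coin tosses: for every round and machine, a string of `coins` bits. -/
abbrev Outcome : Type := Fin A.rounds → Fin m → Fin A.coins → Bool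

/-- The configuration after `t` rounds, when machine `j` starts with `x j` in its memory. -/
def run (x : Fin m → List Bool) (ω : A.Outcome) : ℕ → MPCConfig m
  | 0 => ⟨x, fun _ _ => []⟩
  | t + 1 =>
    let c := run x ω t
    if h : t < A.rounds then
      let r := fun j => A.step t j (c.mem j) (c.inbox j) (ω ⟨t, h⟩ j)
      ⟨fun j => (r j).1, fun j i => (r i).2 j⟩
    else c

/-- The output of the algorithm. -/
def result (x : Fin m → List Bool) (ω : A.Outcome) : Finset (Fin m) :=
  A.output ((A.run x ω A.rounds).mem A.central) ((A.run x ω A.rounds).inbox A.central)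

/-- On input `x`, for all outcomes of the coin tosses, at all times, the memory of each machine
together with all messages that it received in the latest round has at most `s` bits. Also, no
machine draws more than `s` random bits in a round. -/
def SpaceBounded (x : Fin m → List Bool) (s : ℝ) : Prop :=
  (A.coins : ℝ) ≤ s ∧ ∀ ω : A.Outcome, ∀ t ≤ A.rounds, ∀ j,
    (((A.run x ω t).mem j).length + ∑ i, ((A.run x ω t).inbox j i).length : ℕ) ≤ s

/-- On input `x`, after the first `t₀` rounds the machines outside `L`, other than the central
one, neither send nor receive a (nonempty) message. -/
def RestrictsTo (x : Fin m → List Bool) (L : Finset (Fin m)) (t₀ : ℕ) : Prop :=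
  ∀ ω : A.Outcome, ∀ t, t₀ < t → t ≤ A.rounds → ∀ j ∉ L, j ≠ A.central → ∀ i,
    (A.run x ω t).inbox i j = [] ∧ (A.run x ω t).inbox j i = []

/-- The probability of an event, all coin tosses being fair and independent. -/
noncomputable def prob (E : A.Outcome → Prop) : ℝ :=
  (Nat.card {ω : A.Outcome // E ω} : ℝ) / (Nat.card A.Outcome : ℝ)

end MPCAlgorithm

/-- At the start, machine `j` holds the characteristic vector of the set `S j`. -/
def setInput {n m : ℕ} (S : Fin m → Finset (Fin n)) (j : Fin m) : List Bool :=
  List.ofFn fun i => decide (i ∈ S j)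

/-!
The algorithm is a deterministic threshold greedy, carried out by the central machine; hence the
probability of success is one.

*Approximation.* Let `L` be the `⌈k f / ε⌉` largest sets. Every element lies in at most `f` sets,
so some set of `L` overlaps any given union of at most `k` sets in at most an `ε / k` fraction of
`Opt`. Exchanging the optimal sets outside `L` one by one for such sets, which are no smaller,
shows that `L` still contains `k` sets that cover `(1 - ε) Opt`
(`IsLargest.exists_coverage_ge`). On `L`, greedy with thresholds `M (1 - δ) ^ i`, where `M` is
the largest size, picks in each step a set whose marginal is within `1 - δ` of the best one. So
either `k` sets are picked and they cover a `1 - exp (-(1 - δ))` fraction, or all marginals fall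
below the last threshold, which is at most `δ M / k` (`GreedyParams.coverage_greedy`). With
`δ = ε / 4` both errors together stay below `ε`, since greedy loses only a `1 - 1/e` fraction of
the `ε Opt` given up by the restriction to `L` (`approx_factor_le`).

*Rounds and space.* The sizes of all sets add up to at most `f n`. The central machine learns the
sizes in the first round and cuts the sequence of machines into `f + 1` batches of total size at
most `2 n` (`sum_batch_le`), each of which it can receive at once. As marginals only decrease, a
set has to be considered only once per threshold, so a threshold takes `f + 1` rounds. There are
`O(log (k / ε) / ε)` thresholds, which gives `O((f / ε) log (k f / ε))` rounds (`rounds_le`).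
Requests, replies and their evaluation are pipelined; `GreedyParams.inboxSpec_run` describes all
messages at all times.
-/

/-! ### Restriction to the largest sets -/

section Kernel

variable {n m : ℕ}

theorem coverage_le_optCoverage (S : Fin m → Finset (Fin n)) {k : ℕ} (hk : k ≤ m)
    {Z : Finset (Fin m)} (hZ : Z.card ≤ k) : coverage S Z ≤ optCoverage S k := by
  obtain ⟨Y, hZY, -, hY⟩ := Finset.exists_subsuperset_card_eq (Finset.subset_univ Z) hZ
    (by simpa using hk)
  calc coverage S Z ≤ coverage S Y :=
        Finset.card_le_card (Finset.biUnion_subset_biUnion_of_subset_left S hZY)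
    _ ≤ optCoverage S k :=
        Finset.le_sup (f := coverage S) (by simp [Finset.mem_powersetCard, hY])

theorem exists_coverage_eq_optCoverage (S : Fin m → Finset (Fin n)) {k : ℕ} (hk : k ≤ m) :
    ∃ Z : Finset (Fin m), Z.card = k ∧ coverage S Z = optCoverage S k := by
  have hne : (Finset.powersetCard k (Finset.univ : Finset (Fin m))).Nonempty :=
    Finset.powersetCard_nonempty.2 (by simpa using hk)
  obtain ⟨Z, hZ, h⟩ := Finset.exists_mem_eq_sup _ hne (coverage S)
  exact ⟨Z, (Finset.mem_powersetCard.1 hZ).2, h.symm⟩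

theorem sum_card_inter_le (S : Fin m → Finset (Fin n)) (A : Finset (Fin m))
    (C : Finset (Fin n)) : ∑ j ∈ A, (S j ∩ C).card ≤ maxFrequency S * C.card := by
  have h1 : ∀ j, (S j ∩ C).card = ∑ x ∈ C, if x ∈ S j then 1 else 0 := by
    intro j
    rw [Finset.inter_comm, ← Finset.filter_mem_eq_inter, Finset.card_filter]
  simp_rw [h1]
  rw [Finset.sum_comm]
  have h2 : ∀ x ∈ C, (∑ j ∈ A, if x ∈ S j then 1 else 0) ≤ maxFrequency S := by
    intro x _
    rw [← Finset.card_filter]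
    calc (A.filter fun j => x ∈ S j).card ≤ frequency S x :=
          Finset.card_le_card (Finset.filter_subset_filter _ (Finset.subset_univ A))
      _ ≤ maxFrequency S := Finset.le_sup (f := frequency S) (Finset.mem_univ x)
  calc _ ≤ ∑ _x ∈ C, maxFrequency S := Finset.sum_le_sum h2
    _ = maxFrequency S * C.card := by simp [mul_comm]

theorem sum_card_le (S : Fin m → Finset (Fin n)) :
    ∑ j, (S j).card ≤ maxFrequency S * n := by
  simpa using sum_card_inter_le S Finset.univ Finset.univ

theorem coverage_insert (S : Fin m → Finset (Fin n)) (T : Finset (Fin m)) (j : Fin m) :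
    coverage S (insert j T) = coverage S T + (S j \ T.biUnion S).card := by
  unfold coverage
  rw [Finset.biUnion_insert, ← Finset.card_sdiff_add_card, add_comm]

/-- One exchange step: a set outside `L` is replaced by the set of `L` that overlaps least with
the rest of the collection. The average overlap is small because no element lies in more than
`f` sets, and the new set is at least as large as the old one. -/
theorem exists_exchange (S : Fin m → Finset (Fin n)) {L Z : Finset (Fin m)} {i : Fin m} {η : ℝ}
    (hL : L.Nonempty) (hη : (maxFrequency S : ℝ) ≤ η * L.card)
    (hi : ∀ j ∈ L, (S i).card ≤ (S j).card) :
    ∃ j ∈ L, (coverage S (insert i Z) : ℝ) ≤ coverage S (insert j Z) + η * coverage S Z := by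
  have hex : ∃ j ∈ L, ((S j ∩ Z.biUnion S).card : ℝ) ≤ η * coverage S Z := by
    refine Finset.exists_le_of_sum_le hL ?_
    have h := sum_card_inter_le S L (Z.biUnion S)
    calc ∑ j ∈ L, ((S j ∩ Z.biUnion S).card : ℝ) ≤ maxFrequency S * coverage S Z := by
          exact_mod_cast h
      _ ≤ η * L.card * coverage S Z := by gcongr
      _ = ∑ _j ∈ L, η * coverage S Z := by simp; ring
  obtain ⟨j, hj, hjZ⟩ := hex
  refine ⟨j, hj, ?_⟩
  have h1 : (S i \ Z.biUnion S).card ≤ (S i).card := Finset.card_le_card Finset.sdiff_subset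
  have h2 : (S j \ Z.biUnion S).card + (S j ∩ Z.biUnion S).card = (S j).card :=
    Finset.card_sdiff_add_card_inter _ _
  have h3 := hi j hj
  have h4 : ((S i \ Z.biUnion S).card : ℝ)
      ≤ (S j \ Z.biUnion S).card + (S j ∩ Z.biUnion S).card := by
    exact_mod_cast h1.trans (h3.trans h2.ge)
  rw [coverage_insert, coverage_insert]
  push_cast
  linarith

/-- Restricting to the `⌈k f / ε⌉` largest sets costs at most an `ε`-fraction of the optimum. -/
theorem IsLargest.exists_coverage_ge {S : Fin m → Finset (Fin n)} {k : ℕ} {ε : ℝ}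
    {L : Finset (Fin m)} (hε : 0 < ε) (hk : 1 ≤ k) (hkm : k ≤ m) (hf : 1 ≤ maxFrequency S)
    (hL : IsLargest S ⌈(k : ℝ) * maxFrequency S / ε⌉₊ L) :
    ∃ X ⊆ L, X.card ≤ k ∧ (1 - ε) * (optCoverage S k : ℝ) ≤ coverage S X := by
  have hkR : (0 : ℝ) < k := by exact_mod_cast hk
  obtain ⟨Z, hZk, hZ⟩ := exists_coverage_eq_optCoverage S hkm
  rcases le_total m ⌈(k : ℝ) * maxFrequency S / ε⌉₊ with hm | hm
  · have hLu : L = Finset.univ := by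
      apply Finset.eq_univ_of_card
      rw [hL.1, min_eq_right hm, Fintype.card_fin]
    refine ⟨Z, by simp [hLu], hZk.le, ?_⟩
    rw [hZ]
    have : (0 : ℝ) ≤ optCoverage S k := Nat.cast_nonneg _
    nlinarith
  have hLN : (k : ℝ) * maxFrequency S / ε ≤ L.card := by
    rw [hL.1, min_eq_left hm]
    exact Nat.le_ceil _
  have hfR : (1 : ℝ) ≤ maxFrequency S := by exact_mod_cast hf
  have hη : (maxFrequency S : ℝ) ≤ ε / k * L.card := by
    rw [div_le_iff₀ hε] at hLN
    rw [div_mul_eq_mul_div, le_div_iff₀ hkR]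
    linarith
  have hLpos : L.Nonempty := by
    rw [← Finset.card_pos]
    have : (0 : ℝ) < L.card := lt_of_lt_of_le (by positivity) hLN
    exact_mod_cast this
  have key : ∀ r : ℕ, ∀ Y : Finset (Fin m), Y.card ≤ k → (Y \ L).card = r →
      ∃ X ⊆ L, X.card ≤ k ∧
        (coverage S Y : ℝ) ≤ coverage S X + r * (ε / k * optCoverage S k) := by
    intro r
    induction r with
    | zero =>
      intro Y hY h0
      refine ⟨Y, Finset.sdiff_eq_empty_iff_subset.1 (Finset.card_eq_zero.1 h0), hY, by simp⟩
    | succ r ih =>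
      intro Y hY hr
      obtain ⟨i, hi⟩ : (Y \ L).Nonempty := Finset.card_pos.1 (by omega)
      obtain ⟨hiY, hiL⟩ := Finset.mem_sdiff.1 hi
      have hcard : (Y.erase i).card + 1 = Y.card := Finset.card_erase_add_one hiY
      obtain ⟨j, hj, hle⟩ := exists_exchange S (Z := Y.erase i) hLpos hη
        (fun j hj => hL.2 j hj i hiL)
      rw [Finset.insert_erase hiY] at hle
      have hsd : insert j (Y.erase i) \ L = (Y \ L).erase i := by
        rw [Finset.insert_sdiff_of_mem _ hj, Finset.erase_sdiff_comm]
      obtain ⟨X, hXL, hXk, hX⟩ := ih (insert j (Y.erase i))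
        ((Finset.card_insert_le _ _).trans (by omega))
        (by rw [hsd, Finset.card_erase_of_mem hi, hr, Nat.add_sub_cancel])
      refine ⟨X, hXL, hXk, ?_⟩
      have hopt : (coverage S (Y.erase i) : ℝ) ≤ optCoverage S k := by
        exact_mod_cast coverage_le_optCoverage S hkm (by omega)
      have : ε / k * coverage S (Y.erase i) ≤ ε / k * (optCoverage S k : ℝ) := by gcongr
      push_cast
      linarith
  obtain ⟨X, hXL, hXk, hX⟩ := key _ Z hZk.le rfl
  refine ⟨X, hXL, hXk, ?_⟩
  have hr : ((Z \ L).card : ℝ) ≤ k := by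
    exact_mod_cast (Finset.card_le_card Finset.sdiff_subset).trans hZk.le
  have h1 : ((Z \ L).card : ℝ) * (ε / k * optCoverage S k) ≤ k * (ε / k * optCoverage S k) := by
    gcongr
  have h2 : (k : ℝ) * (ε / k * optCoverage S k) = ε * optCoverage S k := by
    field_simp
  rw [hZ] at hX
  linarith

/-- There are `N` largest sets, whatever the sizes; the central machine chooses them from the sizes
alone. -/
theorem exists_largest (sz : Fin m → ℕ) (N : ℕ) :
    ∃ L : Finset (Fin m), L.card = min N m ∧ ∀ i ∈ L, ∀ j ∉ L, sz j ≤ sz i := by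
  induction N with
  | zero => exact ⟨∅, by simp, by simp⟩
  | succ N ih =>
    obtain ⟨L, hL, h⟩ := ih
    by_cases hm : N < m
    · have hne : Lᶜ.Nonempty := by
        rw [← Finset.card_pos, Finset.card_compl, Fintype.card_fin]
        omega
      obtain ⟨a, ha, hmax⟩ := Finset.exists_max_image Lᶜ sz hne
      have haL : a ∉ L := Finset.mem_compl.1 ha
      refine ⟨insert a L, by rw [Finset.card_insert_of_notMem haL]; omega, ?_⟩
      intro i hi j hj
      rw [Finset.mem_insert, not_or] at hj
      rcases Finset.mem_insert.1 hi with rfl | hi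
      · exact hmax j (Finset.mem_compl.2 hj.2)
      · exact h i hi j hj.2
    · exact ⟨L, by omega, h⟩

end Kernel

/-! ### Splitting the machines into batches -/

section Batches

variable {m : ℕ}

/-- The batch of machine `j`: the total size of the sets before `S j`, divided by `n`. -/
def batchOf (n : ℕ) (sz : Fin m → ℕ) (j : Fin m) : ℕ :=
  (∑ i ∈ Finset.Iio j, sz i) / n

theorem batchOf_le {n f : ℕ} (sz : Fin m → ℕ) (h : ∑ j, sz j ≤ f * n) (j : Fin m) :
    batchOf n sz j ≤ f := by
  refine Nat.div_le_of_le_mul ?_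
  calc ∑ i ∈ Finset.Iio j, sz i ≤ ∑ i, sz i :=
        Finset.sum_le_sum_of_subset (Finset.subset_univ _)
    _ ≤ n * f := by rwa [mul_comm]

/-- A batch has total size at most `2 n`: the sets of the batch correspond to disjoint intervals
of these lengths, which start in `[b n, (b + 1) n)` and have length at most `n`. -/
theorem sum_batch_le {n : ℕ} (hn : 0 < n) (sz : Fin m → ℕ) (hsz : ∀ j, sz j ≤ n) (b : ℕ) :
    ∑ j with batchOf n sz j = b, sz j ≤ 2 * n := by
  set P : Fin m → ℕ := fun j => ∑ i ∈ Finset.Iio j, sz i with hP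
  have hstep : ∀ i j : Fin m, i < j → P i + sz i ≤ P j := by
    intro i j hij
    have : P i + sz i = ∑ l ∈ Finset.Iic i, sz l := by
      rw [← Finset.Iio_insert, Finset.sum_insert (by simp), add_comm]
    rw [this]
    refine Finset.sum_le_sum_of_subset fun l hl => ?_
    rw [Finset.mem_Iic] at hl
    exact Finset.mem_Iio.2 (hl.trans_lt hij)
  have hdisj : ∀ i j : Fin m, i ≠ j →
      Disjoint (Finset.Ico (P i) (P i + sz i)) (Finset.Ico (P j) (P j + sz j)) := by
    intro i j hij
    rw [Finset.disjoint_left]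
    intro x hx hy
    rw [Finset.mem_Ico] at hx hy
    rcases lt_or_gt_of_ne hij with h | h
    · have := hstep i j h; omega
    · have := hstep j i h; omega
  calc ∑ j with batchOf n sz j = b, sz j
      = ((Finset.univ.filter fun j => batchOf n sz j = b).biUnion
          fun j => Finset.Ico (P j) (P j + sz j)).card := by
        rw [Finset.card_biUnion fun i _ j _ hij => hdisj i j hij]
        simp
    _ ≤ (Finset.Ico (b * n) ((b + 2) * n)).card := by
        refine Finset.card_le_card fun x hx => ?_
        simp only [Finset.mem_biUnion, Finset.mem_filter, Finset.mem_univ, true_and,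
          Finset.mem_Ico] at hx ⊢
        obtain ⟨j, hj, h1, h2⟩ := hx
        have h3 := hsz j
        have h4 : b * n ≤ P j := by rw [← hj]; exact Nat.div_mul_le_self _ _
        have h5 : P j < (b + 1) * n := by
          rw [← hj]
          exact Nat.lt_mul_of_div_lt (Nat.lt_succ_self _) hn
        have h6 : (b + 2) * n = (b + 1) * n + n := by ring
        omega
    _ = 2 * n := by
        rw [Nat.card_Ico, add_mul, Nat.add_sub_cancel_left]

end Batches

/-! ### Threshold greedy -/

/-- Parameters of the threshold greedy algorithm: it picks at most `k` of the `N` largest sets,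
goes through `q` batches at each threshold, and lowers the threshold by the factor `1 - δ`. -/
structure GreedyParams where
  k : ℕ
  N : ℕ
  q : ℕ
  δ : ℝ

section Greedy

variable {n m : ℕ}

/-- Pick the set `R j` if at least `τ` of its elements are new. A state consists of the indices
picked so far, at most `k`, and of the elements covered by them. -/
noncomputable def consider (R : Fin m → Finset (Fin n)) (k : ℕ) (τ : ℝ)
    (p : Finset (Fin m) × Finset (Fin n)) (j : Fin m) : Finset (Fin m) × Finset (Fin n) :=
  open Classical in
  if j ∉ p.1 ∧ p.1.card < k ∧ τ ≤ ((R j \ p.2).card : ℝ) then (insert j p.1, p.2 ∪ R j) else p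

/-- What the threshold greedy algorithm maintains while all marginals of the sets in `L` are at
most `β`: it has picked at most `k` sets of `L`, and compared with the coverage of `X` each pick
has shrunk the deficit by the factor `1 - (1 - δ) / k`. -/
structure GreedyInv (S : Fin m → Finset (Fin n)) (L X : Finset (Fin m)) (k : ℕ) (δ β : ℝ)
    (p : Finset (Fin m) × Finset (Fin n)) : Prop where
  covered : p.2 = p.1.biUnion S
  subset : p.1 ⊆ L
  card_le : p.1.card ≤ k
  marginal : p.1.card = k ∨ ∀ j ∈ L, ((S j \ p.2).card : ℝ) ≤ β
  deficit : (coverage S X : ℝ) - coverage S p.1 ≤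
    (1 - (1 - δ) / k) ^ p.1.card * coverage S X

/-- The set `S j` need not be considered again at the threshold `τ`. -/
def Settled (S : Fin m → Finset (Fin n)) (k : ℕ) (τ : ℝ)
    (p : Finset (Fin m) × Finset (Fin n)) (j : Fin m) : Prop :=
  p.1.card = k ∨ ((S j \ p.2).card : ℝ) ≤ τ

/-- Subadditivity: what `X` covers is covered by `T` or counted in a marginal with respect to
`T`. -/
theorem coverage_le_add_marginals (S : Fin m → Finset (Fin n)) {X T : Finset (Fin m)} {k : ℕ}
    {β : ℝ} (hβ : 0 ≤ β) (hX : X.card ≤ k)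
    (h : ∀ j ∈ X, ((S j \ T.biUnion S).card : ℝ) ≤ β) :
    (coverage S X : ℝ) ≤ coverage S T + k * β := by
  have h1 : coverage S X ≤ coverage S T + ∑ j ∈ X, (S j \ T.biUnion S).card := by
    unfold coverage
    calc (X.biUnion S).card ≤ (T.biUnion S ∪ X.biUnion fun j => S j \ T.biUnion S).card := by
          refine Finset.card_le_card fun x hx => ?_
          obtain ⟨j, hj, hx⟩ := Finset.mem_biUnion.1 hx
          by_cases hT : x ∈ T.biUnion S
          · exact Finset.mem_union_left _ hT
          · exact Finset.mem_union_right _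
              (Finset.mem_biUnion.2 ⟨j, hj, Finset.mem_sdiff.2 ⟨hx, hT⟩⟩)
      _ ≤ _ := (Finset.card_union_le _ _).trans (by gcongr; exact Finset.card_biUnion_le)
  calc (coverage S X : ℝ) ≤ coverage S T + ∑ j ∈ X, ((S j \ T.biUnion S).card : ℝ) := by
        exact_mod_cast h1
    _ ≤ coverage S T + X.card * β := by
        gcongr
        simpa using Finset.sum_le_card_nsmul X _ β h
    _ ≤ coverage S T + k * β := by gcongr

variable {S : Fin m → Finset (Fin n)} {L X : Finset (Fin m)} {k : ℕ} {δ β τ : ℝ}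
  {p : Finset (Fin m) × Finset (Fin n)}

theorem consider_covered_subset (R : Fin m → Finset (Fin n)) (k : ℕ) (τ : ℝ)
    (p : Finset (Fin m) × Finset (Fin n)) (j : Fin m) : p.2 ⊆ (consider R k τ p j).2 := by
  unfold consider
  split_ifs
  · exact Finset.subset_union_left
  · exact subset_rfl

theorem consider_of_card_eq (R : Fin m → Finset (Fin n)) (hp : p.1.card = k) (j : Fin m) :
    consider R k τ p j = p := by
  unfold consider
  rw [if_neg]
  omega

theorem GreedyInv.consider (hδ₀ : 0 ≤ δ) (hδ : δ ≤ 1) (hβ : 0 ≤ β) (hk : 1 ≤ k)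
    (hτ : (1 - δ) * β ≤ τ) (hXL : X ⊆ L) (hX : X.card ≤ k) (hp : GreedyInv S L X k δ β p)
    {j : Fin m} (hj : j ∈ L) : GreedyInv S L X k δ β (consider S k τ p j) := by
  by_cases hc : j ∉ p.1 ∧ p.1.card < k ∧ τ ≤ ((S j \ p.2).card : ℝ)
  swap
  · have : _root_.consider S k τ p j = p := if_neg hc
    rwa [this]
  obtain ⟨hjp, hlt, hm⟩ := hc
  have heq : _root_.consider S k τ p j = (insert j p.1, p.2 ∪ S j) := if_pos ⟨hjp, hlt, hm⟩
  have hmarg := hp.marginal.resolve_left hlt.ne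
  have hkR : (1 : ℝ) ≤ k := by exact_mod_cast hk
  rw [heq]
  refine ⟨?_, ?_, ?_, Or.inr ?_, ?_⟩
  · simp only [Finset.biUnion_insert, hp.covered, Finset.union_comm]
  · exact Finset.insert_subset hj hp.subset
  · simp only [Finset.card_insert_of_notMem hjp]
    omega
  · intro i hi
    refine le_trans ?_ (hmarg i hi)
    exact_mod_cast Finset.card_le_card
      (Finset.sdiff_subset_sdiff subset_rfl Finset.subset_union_left)
  · have h1 : (coverage S X : ℝ) ≤ coverage S p.1 + k * β :=
      coverage_le_add_marginals S hβ hX fun i hi => by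
        rw [← hp.covered]; exact hmarg i (hXL hi)
    have h2 : (coverage S (insert j p.1) : ℝ) = coverage S p.1 + (S j \ p.2).card := by
      rw [coverage_insert, hp.covered]
      push_cast
      rfl
    simp only [Finset.card_insert_of_notMem hjp, pow_succ]
    have h3 : (1 - δ) / k * (coverage S X - coverage S p.1 : ℝ) ≤ (S j \ p.2).card := by
      refine le_trans ?_ (hτ.trans hm)
      rw [div_mul_eq_mul_div, div_le_iff₀ (by linarith), mul_assoc]
      refine mul_le_mul_of_nonneg_left ?_ (by linarith)
      linarith
    have h4 : (0 : ℝ) ≤ 1 - (1 - δ) / k := by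
      rw [sub_nonneg, div_le_one (by linarith)]
      linarith
    calc (coverage S X : ℝ) - coverage S (insert j p.1)
        ≤ (coverage S X - coverage S p.1) * (1 - (1 - δ) / k) := by rw [h2]; linarith
      _ ≤ (1 - (1 - δ) / k) ^ p.1.card * coverage S X * (1 - (1 - δ) / k) := by
          gcongr
          exact hp.deficit
      _ = _ := by ring

theorem Settled.consider {i : Fin m} (h : Settled S k τ p i) (j : Fin m) :
    Settled S k τ (consider S k τ p j) i := by
  rcases h with h | h
  · exact Or.inl (by rw [consider_of_card_eq S h]; exact h)
  · refine Or.inr (le_trans ?_ h)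
    exact_mod_cast Finset.card_le_card
      (Finset.sdiff_subset_sdiff subset_rfl (consider_covered_subset S k τ p j))

theorem settled_consider_self (hτ : 0 ≤ τ) (hp : GreedyInv S L X k δ β p) (j : Fin m) :
    Settled S k τ (consider S k τ p j) j := by
  by_cases hc : j ∉ p.1 ∧ p.1.card < k ∧ τ ≤ ((S j \ p.2).card : ℝ)
  · have heq : _root_.consider S k τ p j = (insert j p.1, p.2 ∪ S j) := if_pos hc
    right
    rw [heq, Finset.sdiff_eq_empty_iff_subset.2 Finset.subset_union_right]
    simpa using hτ
  · have heq : _root_.consider S k τ p j = p := if_neg hc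
    rw [heq]
    by_cases hj : j ∈ p.1
    · right
      rw [hp.covered, Finset.sdiff_eq_empty_iff_subset.2 (Finset.subset_biUnion_of_mem S hj)]
      simpa using hτ
    · by_cases hk : p.1.card < k
      · exact Or.inr (le_of_not_ge fun h => hc ⟨hj, hk, h⟩)
      · exact Or.inl (le_antisymm hp.card_le (not_lt.1 hk))

theorem GreedyInv.foldl_consider (hδ₀ : 0 ≤ δ) (hδ : δ ≤ 1) (hβ : 0 ≤ β) (hk : 1 ≤ k)
    (hτ : (1 - δ) * β ≤ τ) (hXL : X ⊆ L) (hX : X.card ≤ k) (l : List (Fin m))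
    (hp : GreedyInv S L X k δ β p) (hl : ∀ j ∈ l, j ∈ L) :
    GreedyInv S L X k δ β (l.foldl (_root_.consider S k τ) p) ∧
      ∀ i, (i ∈ l ∨ Settled S k τ p i) → Settled S k τ (l.foldl (_root_.consider S k τ) p) i := by
  have hτ₀ : 0 ≤ τ := le_trans (mul_nonneg (by linarith) hβ) hτ
  induction l generalizing p with
  | nil => exact ⟨hp, fun i hi => by simpa using hi⟩
  | cons a l ih =>
    have ha := hp.consider hδ₀ hδ hβ hk hτ hXL hX (hl a List.mem_cons_self)
    obtain ⟨h1, h2⟩ := ih ha fun j hj => hl j (List.mem_cons_of_mem a hj)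
    refine ⟨h1, fun i hi => h2 i ?_⟩
    rcases hi with hi | hi
    · rcases List.mem_cons.1 hi with rfl | hi
      · exact Or.inr (settled_consider_self hτ₀ hp i)
      · exact Or.inl hi
    · exact Or.inr (hi.consider a)

end Greedy

namespace GreedyParams

variable {n m : ℕ} (P : GreedyParams)

/-- The `N` largest sets, in terms of the sizes of the sets. -/
noncomputable def largest (sz : Fin m → ℕ) : Finset (Fin m) :=
  (exists_largest sz P.N).choose

theorem isLargest_largest (S : Fin m → Finset (Fin n)) :
    IsLargest S P.N (P.largest fun j => (S j).card) :=
  (exists_largest (fun j => (S j).card) P.N).choose_spec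

/-- The sets that are considered in turn `r`. -/
noncomputable def block (n : ℕ) (sz : Fin m → ℕ) (r : ℕ) : Finset (Fin m) :=
  (P.largest sz).filter fun j => batchOf n sz j = r % P.q

/-- The threshold in turn `r`. -/
noncomputable def threshold (sz : Fin m → ℕ) (r : ℕ) : ℝ :=
  ((Finset.univ.sup sz : ℕ) : ℝ) * (1 - P.δ) ^ (r / P.q + 1)

/-- Turn `r`: consider the sets of the block one by one. -/
noncomputable def turn (sz : Fin m → ℕ) (R : Fin m → Finset (Fin n)) (r : ℕ)
    (p : Finset (Fin m) × Finset (Fin n)) : Finset (Fin m) × Finset (Fin n) :=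
  (P.block n sz r).toList.foldl (consider R P.k (P.threshold sz r)) p

theorem turn_congr (sz : Fin m → ℕ) {R R' : Fin m → Finset (Fin n)} (r : ℕ)
    (p : Finset (Fin m) × Finset (Fin n)) (h : ∀ j ∈ P.block n sz r, R j = R' j) :
    P.turn sz R r p = P.turn sz R' r p := by
  refine List.foldl_ext _ _ _ fun p j hj => ?_
  unfold consider
  rw [h j (Finset.mem_toList.1 hj)]

/-- The state of the threshold greedy algorithm after `r` turns. -/
noncomputable def greedy (S : Fin m → Finset (Fin n)) : ℕ → Finset (Fin m) × Finset (Fin n)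
  | 0 => (∅, ∅)
  | r + 1 => P.turn (fun j => (S j).card) S r (greedy S r)

variable {P} {S : Fin m → Finset (Fin n)} {X : Finset (Fin m)}

/-- After all batches have been considered at the `l` highest thresholds, every marginal is at
most the last threshold, unless `k` sets have been picked. -/
theorem greedyInv_greedy (hδ₀ : 0 ≤ P.δ) (hδ : P.δ ≤ 1) (hk : 1 ≤ P.k)
    (hq : ∀ j, batchOf n (fun j => (S j).card) j < P.q)
    (hXL : X ⊆ P.largest fun j => (S j).card) (hX : X.card ≤ P.k) (l : ℕ) :
    GreedyInv S (P.largest fun j => (S j).card) X P.k P.δ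
      ((Finset.univ.sup fun j => (S j).card : ℕ) * (1 - P.δ) ^ l) (P.greedy S (P.q * l)) := by
  set sz : Fin m → ℕ := fun j => (S j).card with hsz
  have h0 : (0 : ℝ) ≤ 1 - P.δ := by linarith
  induction l with
  | zero =>
    refine ⟨by simp [greedy], by simp [greedy], by simp [greedy], Or.inr fun j _ => ?_, ?_⟩
    · have h1 : (S j \ (∅ : Finset (Fin n))).card ≤ Finset.univ.sup sz := by
        rw [Finset.sdiff_empty]
        exact Finset.le_sup (f := sz) (Finset.mem_univ j)
      simpa [greedy] using h1
    · simp [greedy, coverage]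
  | succ l ih =>
    set β : ℝ := (Finset.univ.sup sz : ℕ) * (1 - P.δ) ^ l with hβ
    set τ : ℝ := (Finset.univ.sup sz : ℕ) * (1 - P.δ) ^ (l + 1) with hτ
    have hβ₀ : 0 ≤ β := by positivity
    have hτβ : (1 - P.δ) * β = τ := by rw [hτ, pow_succ, hβ]; ring
    -- While the batches are gone through at one threshold, the marginals stay at most `β`, and the
    -- batches that have had their turn are settled.
    have key : ∀ b ≤ P.q, GreedyInv S (P.largest sz) X P.k P.δ β (P.greedy S (P.q * l + b)) ∧
        ∀ j ∈ P.largest sz, batchOf n sz j < b →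
          Settled S P.k τ (P.greedy S (P.q * l + b)) j := by
      intro b
      induction b with
      | zero => exact fun _ => ⟨ih, fun j _ h => absurd h (Nat.not_lt_zero _)⟩
      | succ b ihb =>
        intro hb
        obtain ⟨h1, h2⟩ := ihb (by omega)
        have hth : P.threshold sz (P.q * l + b) = τ := by
          rw [threshold, Nat.mul_add_div (by omega), Nat.div_eq_of_lt (by omega), add_zero]
        have hmod : (P.q * l + b) % P.q = b := by
          rw [Nat.mul_add_mod, Nat.mod_eq_of_lt (by omega)]
        have hgreedy : P.greedy S (P.q * l + (b + 1)) =
            (P.block n sz (P.q * l + b)).toList.foldl (consider S P.k τ)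
              (P.greedy S (P.q * l + b)) := by
          rw [← hth]; rfl
        obtain ⟨h3, h4⟩ := h1.foldl_consider hδ₀ hδ hβ₀ hk hτβ.le hXL hX
          (P.block n sz (P.q * l + b)).toList
          (fun j hj => (Finset.mem_filter.1 (Finset.mem_toList.1 hj)).1)
        rw [hgreedy]
        refine ⟨h3, fun j hj hjb => h4 j ?_⟩
        rcases Nat.lt_succ_iff_lt_or_eq.1 hjb with h | h
        · exact Or.inr (h2 j hj h)
        · exact Or.inl (Finset.mem_toList.2 (Finset.mem_filter.2 ⟨hj, by rw [hmod, h]⟩))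
    obtain ⟨h1, h2⟩ := key P.q le_rfl
    rw [Nat.mul_succ]
    refine ⟨h1.covered, h1.subset, h1.card_le, ?_, h1.deficit⟩
    by_cases hc : (P.greedy S (P.q * l + P.q)).1.card = P.k
    · exact Or.inl hc
    · exact Or.inr fun j hj => (h2 j hj (hq j)).resolve_left hc

/-- Threshold greedy covers a `1 - exp (-(1 - δ))` fraction of what `X` covers if it picks `k`
sets, and almost everything that `X` covers if it picks fewer. -/
theorem coverage_greedy (hδ₀ : 0 ≤ P.δ) (hδ : P.δ ≤ 1) (hk : 1 ≤ P.k)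
    (hq : ∀ j, batchOf n (fun j => (S j).card) j < P.q)
    (hXL : X ⊆ P.largest fun j => (S j).card) (hX : X.card ≤ P.k) (l : ℕ) :
    (1 - Real.exp (-(1 - P.δ))) * (coverage S X : ℝ) ≤ coverage S (P.greedy S (P.q * l)).1 ∨
      (coverage S X : ℝ) ≤ coverage S (P.greedy S (P.q * l)).1 +
        P.k * ((Finset.univ.sup fun j => (S j).card : ℕ) * (1 - P.δ) ^ l) := by
  have h := greedyInv_greedy hδ₀ hδ hk hq hXL hX l
  have hkR : (1 : ℝ) ≤ P.k := by exact_mod_cast hk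
  have h0 : (0 : ℝ) ≤ 1 - P.δ := by linarith
  rcases h.marginal with hc | hm
  · left
    have h1 := h.deficit
    rw [hc] at h1
    have h2 : (1 - (1 - P.δ) / P.k) ^ P.k ≤ Real.exp (-(1 - P.δ)) :=
      Real.one_sub_div_pow_le_exp_neg (by linarith)
    have h3 : (1 - (1 - P.δ) / P.k) ^ P.k * (coverage S X : ℝ) ≤
        Real.exp (-(1 - P.δ)) * coverage S X := by gcongr
    linarith
  · right
    refine coverage_le_add_marginals S (by positivity) hX fun j hj => ?_
    rw [← h.covered]
    exact hm j (hXL hj)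

end GreedyParams

/-! ### Bit strings -/

section Encodings

theorem exists_fixedLength_encoding {α : Type*} [Fintype α] {b : ℕ}
    (h : Fintype.card α ≤ 2 ^ b) :
    ∃ e : α → List Bool, Function.Injective e ∧ ∀ x, (e x).length = b := by
  obtain ⟨g⟩ : Nonempty (α ↪ (Fin b → Bool)) :=
    Function.Embedding.nonempty_of_card_le (by simpa using h)
  exact ⟨fun x => List.ofFn (g x), fun x y hxy => g.injective (List.ofFn_injective hxy),
    fun x => by simp⟩

/-- The number of bits used for a number in `{0, …, n}`. -/
def wordLength (n : ℕ) : ℕ := Nat.log 2 n + 1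

theorem succ_le_two_pow_wordLength (n : ℕ) : n + 1 ≤ 2 ^ wordLength n :=
  Nat.lt_pow_succ_log_self (by norm_num) n

/-- A subset of `[n]` can be encoded with one word for each of its elements: there are at most
`n ^ s` subsets of size `s`, and the length of the code reveals `s`. -/
theorem exists_finset_encoding (n : ℕ) :
    ∃ e : Finset (Fin n) → List Bool, Function.Injective e ∧
      ∀ A, (e A).length = wordLength n * A.card := by
  have h : ∀ s : ℕ, ∃ e : {A : Finset (Fin n) // A.card = s} → List Bool,
      Function.Injective e ∧ ∀ A, (e A).length = wordLength n * s := by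
    intro s
    refine exists_fixedLength_encoding ?_
    rw [Fintype.card_finset_len, Fintype.card_fin, pow_mul]
    exact (Nat.choose_le_pow n s).trans
      (Nat.pow_le_pow_left ((Nat.le_succ n).trans (succ_le_two_pow_wordLength n)) s)
  choose e he hlen using h
  refine ⟨fun A => e A.card ⟨A, rfl⟩, fun A B hAB => ?_, fun A => hlen _ _⟩
  have hcard : A.card = B.card := by
    have h1 := congrArg List.length hAB
    simp only [hlen] at h1
    exact Nat.eq_of_mul_eq_mul_left (Nat.succ_pos _) h1
  have key : ∀ (s t : ℕ) (hs : A.card = s) (ht : B.card = t), s = t →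
      e s ⟨A, hs⟩ = e t ⟨B, ht⟩ → A = B := by
    rintro s _ hs ht rfl h1
    exact congrArg Subtype.val (he s h1)
  exact key _ _ rfl rfl hcard hAB

/-- The code of a set of size `s` has `s` words. -/
noncomputable def encSet (n : ℕ) : Finset (Fin n) → List Bool :=
  (exists_finset_encoding n).choose

theorem encSet_injective (n : ℕ) : Function.Injective (encSet n) :=
  (exists_finset_encoding n).choose_spec.1

theorem length_encSet {n : ℕ} (A : Finset (Fin n)) :
    (encSet n A).length = wordLength n * A.card :=
  (exists_finset_encoding n).choose_spec.2 A

theorem exists_size_encoding (n : ℕ) :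
    ∃ e : Fin (n + 1) → List Bool, Function.Injective e ∧ ∀ x, (e x).length = wordLength n :=
  exists_fixedLength_encoding (by simpa using succ_le_two_pow_wordLength n)

/-- The code of a number in `{0, …, n}` is one word. -/
noncomputable def encSize (n : ℕ) : Fin (n + 1) → List Bool :=
  (exists_size_encoding n).choose

theorem encSize_injective (n : ℕ) : Function.Injective (encSize n) :=
  (exists_size_encoding n).choose_spec.1

theorem length_encSize {n : ℕ} (x : Fin (n + 1)) : (encSize n x).length = wordLength n :=
  (exists_size_encoding n).choose_spec.2 x

/-- What the central machine remembers: the sizes of all sets, the indices of the sets that it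
has picked, and the elements covered by these. -/
abbrev CentralState (n m : ℕ) : Type :=
  (Fin m → Fin (n + 1)) × Finset (Fin m) × Finset (Fin n)

theorem exists_state_encoding (n m : ℕ) :
    ∃ e : CentralState n m → List Bool, Function.Injective e ∧
      ∀ x, (e x).length = wordLength n * m + (m + n) := by
  refine exists_fixedLength_encoding ?_
  simp only [Fintype.card_prod, Fintype.card_pi, Finset.prod_const, Fintype.card_fin,
    Finset.card_univ, Fintype.card_finset]
  rw [pow_add, pow_add, pow_mul]
  gcongr
  exact succ_le_two_pow_wordLength n

/-- The code of the state of the central machine. -/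
noncomputable def encState (n m : ℕ) : CentralState n m → List Bool :=
  (exists_state_encoding n m).choose

theorem encState_injective (n m : ℕ) : Function.Injective (encState n m) :=
  (exists_state_encoding n m).choose_spec.1

theorem length_encState {n m : ℕ} (x : CentralState n m) :
    (encState n m x).length = wordLength n * m + (m + n) :=
  (exists_state_encoding n m).choose_spec.2 x

/-- The set with the given characteristic vector. -/
def decMem (n : ℕ) (l : List Bool) : Finset (Fin n) :=
  Finset.univ.filter fun i => l.getD i false = true

theorem decMem_setInput {n m : ℕ} (S : Fin m → Finset (Fin n)) (j : Fin m) :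
    decMem n (setInput S j) = S j := by
  ext i
  simp [decMem, setInput]

end Encodings

/-! ### The algorithm -/

section Algorithm

variable {n m : ℕ}

/-- The size of a subset of `[n]`. -/
def sizeOfSet (A : Finset (Fin n)) : Fin (n + 1) :=
  ⟨A.card, Nat.lt_succ_of_le (by simpa using Finset.card_le_univ A)⟩

namespace GreedyParams

variable (P : GreedyParams)

/-- The sizes that the central machine `z` learns in the first round; its own set is in its
memory. -/
noncomputable def receivedSizes (z : Fin m) (mem : List Bool) (inbox : Fin m → List Bool) :
    Fin m → Fin (n + 1) :=
  fun j => if j = z then sizeOfSet (decMem n mem) else Function.invFun (encSize n) (inbox j)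

/-- The sets that the central machine `z` has received, together with its own one. -/
noncomputable def receivedSets (z : Fin m) (mem : List Bool) (inbox : Fin m → List Bool) :
    Fin m → Finset (Fin n) :=
  fun j => if j = z then decMem n mem else Function.invFun (encSet n) (inbox j)

/-- Turn `r` of the threshold greedy algorithm on the state of the central machine. -/
noncomputable def stateTurn (r : ℕ) (R : Fin m → Finset (Fin n)) (s : CentralState n m) :
    CentralState n m :=
  (s.1, P.turn (fun j => s.1 j) R r s.2)

/-- The new state of the central machine `z` in round `t ≥ 1`. A block is requested in round
`r + 1`, it is sent in round `r + 2`, and turn `r` takes place in round `r + 3`. -/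
noncomputable def centralUpdate (z : Fin m) (t : ℕ) (mem : List Bool)
    (inbox : Fin m → List Bool) : CentralState n m :=
  if t = 1 then (receivedSizes z mem inbox, ∅, ∅)
  else if t = 2 then Function.invFun (encState n m) (inbox z)
  else P.stateTurn (t - 3) (receivedSets z mem inbox)
    (Function.invFun (encState n m) (inbox z))

/-- The messages of the central machine `z` in round `t`: its state to itself, and one bit to
each machine whose set is requested. -/
noncomputable def centralMessage (n : ℕ) (z : Fin m) (t : ℕ) (mem : List Bool)
    (inbox : Fin m → List Bool) (i : Fin m) : List Bool :=
  if t = 0 then []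
  else
    let s : CentralState n m := P.centralUpdate z t mem inbox
    if i = z then encState n m s
    else if i ∈ P.block n (fun j => s.1 j) (t - 1) then [true] else []

/-- The message of the other machines to the central machine `z` in round `t`: the size of their
set in the first round, and their set whenever it has been requested. -/
noncomputable def machineMessage (n : ℕ) (z : Fin m) (t : ℕ) (mem : List Bool)
    (inbox : Fin m → List Bool) (i : Fin m) : List Bool :=
  if i = z then
    if t = 0 then encSize n (sizeOfSet (decMem n mem))
    else if inbox z = [] then [] else encSet n (decMem n mem)
  else []

/-- A set of `k` elements of `L` that contains `T`, if there is one. -/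
noncomputable def fillUp (k : ℕ) (L T : Finset (Fin m)) : Finset (Fin m) :=
  open Classical in
  if h : ∃ Y, T ⊆ Y ∧ Y ⊆ L ∧ Y.card = k then h.choose else ∅

/-- Threshold greedy with `l` thresholds on `m` machines with central machine `z`. No machine
changes its memory; the central machine keeps its state in a message to itself. No coins are
tossed. -/
noncomputable def algorithm (n : ℕ) (z : Fin m) (l : ℕ) : MPCAlgorithm m where
  rounds := P.q * l + 3
  coins := 0
  central := z
  step t j mem inbox _ :=
    (mem, if j = z then P.centralMessage n z t mem inbox else machineMessage n z t mem inbox)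
  output _ inbox :=
    let s : CentralState n m := Function.invFun (encState n m) (inbox z)
    fillUp P.k (P.largest fun j => s.1 j) s.2.1

/-- The sizes of the sets. -/
def sizes (S : Fin m → Finset (Fin n)) : Fin m → ℕ := fun j => (S j).card

/-- The state of the central machine after `r` turns. -/
noncomputable def centralState (S : Fin m → Finset (Fin n)) (r : ℕ) : CentralState n m :=
  (fun j => sizeOfSet (S j), P.greedy S r)

theorem stateTurn_centralState (S R : Fin m → Finset (Fin n)) (r : ℕ)
    (hR : ∀ j ∈ P.block n (sizes S) r, R j = S j) :
    P.stateTurn r R (P.centralState S r) = P.centralState S (r + 1) :=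
  Prod.ext rfl (P.turn_congr (sizes S) r _ hR)

theorem run_mem (z : Fin m) (l : ℕ) (x : Fin m → List Bool)
    (ω : (P.algorithm n z l).Outcome) (t : ℕ) (j : Fin m) :
    ((P.algorithm n z l).run x ω t).mem j = x j := by
  induction t with
  | zero => rfl
  | succ t ih =>
    simp only [MPCAlgorithm.run]
    split_ifs with h
    · exact ih
    · exact ih

theorem run_inbox_succ (z : Fin m) (l : ℕ) (x : Fin m → List Bool)
    (ω : (P.algorithm n z l).Outcome) {t : ℕ} (ht : t < P.q * l + 3) (i j : Fin m) :
    ((P.algorithm n z l).run x ω (t + 1)).inbox i j =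
      if j = z then P.centralMessage n z t (x z) (((P.algorithm n z l).run x ω t).inbox z) i
      else machineMessage n z t (x j) (((P.algorithm n z l).run x ω t).inbox j) i := by
  have h : t < (P.algorithm n z l).rounds := ht
  have hrun : ((P.algorithm n z l).run x ω (t + 1)).inbox i j =
      ((P.algorithm n z l).step t j (((P.algorithm n z l).run x ω t).mem j)
        (((P.algorithm n z l).run x ω t).inbox j) (ω ⟨t, h⟩ j)).2 i := by
    simp only [MPCAlgorithm.run, dif_pos h]
  rw [hrun, P.run_mem]
  by_cases hj : j = z
  · subst hj
    simp only [algorithm, if_true]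
  · simp only [algorithm, if_neg hj]

/-- The messages that are in the inboxes after `t ≥ 2` rounds. -/
structure InboxSpec (S : Fin m → Finset (Fin n)) (z : Fin m) (t : ℕ)
    (inbox : Fin m → Fin m → List Bool) : Prop where
  state : inbox z z = encState n m (P.centralState S (t - 3))
  reply : ∀ j ≠ z, inbox z j =
    if 3 ≤ t ∧ j ∈ P.block n (sizes S) (t - 3) then encSet n (S j) else []
  request : ∀ j ≠ z, inbox j z = if j ∈ P.block n (sizes S) (t - 2) then [true] else []
  other : ∀ i ≠ z, ∀ j ≠ z, inbox i j = []

variable (S : Fin m → Finset (Fin n)) (z : Fin m) (l : ℕ) (ω : (P.algorithm n z l).Outcome)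

/-- After the first round, the central machine has the sizes and all other inboxes are empty. -/
theorem run_one_inbox (i j : Fin m) :
    ((P.algorithm n z l).run (setInput S) ω 1).inbox i j =
      if i = z ∧ j ≠ z then encSize n (sizeOfSet (S j)) else [] := by
  rw [← Nat.zero_add 1, P.run_inbox_succ z l _ ω (by omega)]
  by_cases hj : j = z
  · simp [hj, centralMessage]
  · by_cases hi : i = z <;> simp [hi, hj, machineMessage, decMem_setInput]

theorem receivedSizes_run_one :
    receivedSizes z (setInput S z) (((P.algorithm n z l).run (setInput S) ω 1).inbox z) =
      fun j => sizeOfSet (S j) := by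
  funext j
  unfold receivedSizes
  split_ifs with h
  · rw [decMem_setInput, h]
  · rw [P.run_one_inbox S z l ω, if_pos ⟨rfl, h⟩,
      Function.leftInverse_invFun (encSize_injective n)]

/-- The messages of round `t`, given that the central machine arrives at the right state and that
the machines have been asked for the right sets. -/
theorem inboxSpec_of_centralUpdate {t : ℕ} (h1 : 1 ≤ t) (ht : t < P.q * l + 3)
    (hs : P.centralUpdate z t (setInput S z)
      (((P.algorithm n z l).run (setInput S) ω t).inbox z) = P.centralState S (t + 1 - 3))
    (hreq : ∀ j ≠ z, ((P.algorithm n z l).run (setInput S) ω t).inbox j z =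
      if 2 ≤ t ∧ j ∈ P.block n (sizes S) (t - 2) then [true] else []) :
    P.InboxSpec S z (t + 1) ((P.algorithm n z l).run (setInput S) ω (t + 1)).inbox := by
  have ht0 : t ≠ 0 := by omega
  have h3 : t + 1 - 3 = t - 2 := by omega
  have h2 : t + 1 - 2 = t - 1 := by omega
  refine ⟨?_, fun j hj => ?_, fun j hj => ?_, fun i hi j hj => ?_⟩ <;>
    rw [P.run_inbox_succ z l _ ω ht]
  · rw [if_pos rfl, centralMessage, if_neg ht0]
    simp only [if_true, hs]
  · rw [if_neg hj, machineMessage, if_pos rfl, if_neg ht0, hreq j hj, decMem_setInput, h3]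
    have h4 : 3 ≤ t + 1 ↔ 2 ≤ t := by omega
    by_cases hc : 2 ≤ t ∧ j ∈ P.block n (sizes S) (t - 2) <;> simp [h4, hc]
  · rw [if_pos rfl, centralMessage, if_neg ht0]
    simp only [if_neg hj, hs, h2]
    rfl
  · rw [if_neg hj, machineMessage, if_neg hi]

theorem inboxSpec_run {t : ℕ} (h2 : 2 ≤ t) (ht : t ≤ P.q * l + 3) :
    P.InboxSpec S z t ((P.algorithm n z l).run (setInput S) ω t).inbox := by
  induction t, h2 using Nat.le_induction with
  | base =>
    refine P.inboxSpec_of_centralUpdate S z l ω le_rfl (by omega) ?_ fun j hj => ?_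
    · rw [centralUpdate, if_pos rfl, P.receivedSizes_run_one]
      rfl
    · rw [P.run_one_inbox]
      simp [hj]
  | succ t h2 ih =>
    have hI := ih (by omega)
    refine P.inboxSpec_of_centralUpdate S z l ω (by omega) (by omega) ?_ fun j hj => ?_
    · rw [centralUpdate, if_neg (by omega), hI.state,
        Function.leftInverse_invFun (encState_injective n m)]
      split_ifs with h
      · subst h
        rfl
      · have h3 : t + 1 - 3 = t - 3 + 1 := by omega
        rw [h3]
        refine P.stateTurn_centralState S _ _ fun j hj => ?_
        unfold receivedSets
        split_ifs with hjz
        · rw [decMem_setInput, hjz]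
        · rw [hI.reply j hjz, if_pos ⟨by omega, hj⟩,
            Function.leftInverse_invFun (encSet_injective n)]
    · rw [hI.request j hj]
      simp [h2]

theorem result_algorithm : (P.algorithm n z l).result (setInput S) ω =
    fillUp P.k (P.largest (sizes S)) (P.greedy S (P.q * l)).1 := by
  have h := (P.inboxSpec_run S z l ω (t := P.q * l + 3) (by omega) le_rfl).state
  have h' : ((P.algorithm n z l).run (setInput S) ω (P.algorithm n z l).rounds).inbox z z =
    encState n m (P.centralState S (P.q * l)) := h
  simp only [MPCAlgorithm.result]
  change fillUp P.k (P.largest fun j => (Function.invFun (encState n m)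
    (((P.algorithm n z l).run (setInput S) ω (P.algorithm n z l).rounds).inbox z z)).1 j)
    (Function.invFun (encState n m) (((P.algorithm n z l).run (setInput S) ω
      (P.algorithm n z l).rounds).inbox z z)).2.1 = _
  rw [h', Function.leftInverse_invFun (encState_injective n m)]
  rfl

theorem restrictsTo_algorithm :
    (P.algorithm n z l).RestrictsTo (setInput S) (P.largest (sizes S)) 1 := by
  intro ω t h1 ht j hj hjz i
  have hI := P.inboxSpec_run S z l ω h1 ht
  have hb : ∀ r, j ∉ P.block n (sizes S) r := fun r h => hj (Finset.mem_filter.1 h).1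
  have hjz : j ≠ z := hjz
  by_cases hi : i = z
  · subst hi
    rw [hI.reply j hjz, hI.request j hjz]
    simp [hb]
  · exact ⟨hI.other i hi j hjz, hI.other j hjz i hi⟩

theorem card_fillUp {k : ℕ} {L T : Finset (Fin m)} (hT : T ⊆ L) (hTk : T.card ≤ k)
    (hk : k ≤ L.card) : T ⊆ fillUp k L T ∧ fillUp k L T ⊆ L ∧ (fillUp k L T).card = k := by
  have h : ∃ Y, T ⊆ Y ∧ Y ⊆ L ∧ Y.card = k := Finset.exists_subsuperset_card_eq hT hTk hk
  rw [fillUp, dif_pos h]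
  exact h.choose_spec

/-- The number of bits that a machine holds: its set, for the central machine the state, and the
sets of one batch or the sizes of all sets. -/
theorem space_algorithm (hn : 0 < n) (hmn : m ≤ n) {t : ℕ} (ht : t ≤ P.q * l + 3) (j : Fin m) :
    (((P.algorithm n z l).run (setInput S) ω t).mem j).length +
      ∑ i, (((P.algorithm n z l).run (setInput S) ω t).inbox j i).length ≤
        6 * (n * wordLength n) := by
  have hw : 1 ≤ wordLength n := Nat.succ_pos _
  have hnw : n ≤ n * wordLength n := Nat.le_mul_of_pos_right n hw
  have hmw : m * wordLength n ≤ n * wordLength n := Nat.mul_le_mul_right _ hmn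
  rw [P.run_mem]
  have hx : (setInput S j).length = n := by simp [setInput]
  rw [hx]
  suffices h : ∑ i, (((P.algorithm n z l).run (setInput S) ω t).inbox j i).length ≤
      5 * (n * wordLength n) by omega
  rcases Nat.lt_or_ge t 2 with h2 | h2
  · interval_cases t
    · simp [MPCAlgorithm.run]
    · calc _ ≤ ∑ _i : Fin m, wordLength n := by
            refine Finset.sum_le_sum fun i _ => ?_
            rw [P.run_one_inbox]
            split_ifs
            · exact (length_encSize _).le
            · simp
        _ = m * wordLength n := by simp
        _ ≤ _ := by omega
  · have hI := P.inboxSpec_run S z l ω h2 ht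
    rw [← Finset.add_sum_erase _ _ (Finset.mem_univ z)]
    by_cases hj : j = z
    · subst hj
      rw [hI.state, length_encState]
      have hsum : ∑ i ∈ Finset.univ.erase j,
          (((P.algorithm n j l).run (setInput S) ω t).inbox j i).length ≤
            wordLength n * (2 * n) := by
        calc _ ≤ ∑ i ∈ Finset.univ.erase j,
              if batchOf n (sizes S) i = (t - 3) % P.q then wordLength n * sizes S i else 0 := by
              refine Finset.sum_le_sum fun i hi => ?_
              rw [hI.reply i (Finset.ne_of_mem_erase hi)]
              split_ifs with h1 h2 h2
              · exact (length_encSet _).le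
              · exact absurd (Finset.mem_filter.1 h1.2).2 h2
              · simp
              · simp
          _ ≤ ∑ i, if batchOf n (sizes S) i = (t - 3) % P.q then wordLength n * sizes S i
                else 0 := Finset.sum_le_sum_of_subset (Finset.erase_subset _ _)
          _ = wordLength n * ∑ i with batchOf n (sizes S) i = (t - 3) % P.q, sizes S i := by
              rw [← Finset.sum_filter, Finset.mul_sum]
          _ ≤ _ := by
              gcongr
              exact sum_batch_le hn (sizes S)
                (fun i => by simpa [sizes] using Finset.card_le_univ (S i)) _
      have e1 : wordLength n * (2 * n) = 2 * (n * wordLength n) := by ring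
      have e2 : wordLength n * m = m * wordLength n := mul_comm _ _
      omega
    · have hsum : ∑ i ∈ Finset.univ.erase z,
          (((P.algorithm n z l).run (setInput S) ω t).inbox j i).length = 0 := by
        refine Finset.sum_eq_zero fun i hi => ?_
        rw [hI.other j hj i (Finset.ne_of_mem_erase hi)]
        rfl
      have h1 : (((P.algorithm n z l).run (setInput S) ω t).inbox j z).length ≤ 1 := by
        rw [hI.request j hj]
        split_ifs <;> simp
      omega

end GreedyParams

end Algorithm

/-! ### Choice of the parameters -/

theorem wordLength_le {n : ℕ} (hn : 1 ≤ n) : (wordLength n : ℝ) ≤ 2 * (1 + Real.log n) := by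
  have hpos : (0 : ℝ) < n := by exact_mod_cast hn
  have h1 : ((2 : ℝ) ^ Nat.log 2 n) ≤ n := by
    exact_mod_cast Nat.pow_log_le_self 2 (by omega)
  have h2 := Real.log_le_log (by positivity) h1
  rw [Real.log_pow] at h2
  have h3 : (1 / 2 : ℝ) ≤ Real.log 2 := by linarith [Real.log_two_gt_d9]
  have h4 : (Nat.log 2 n : ℝ) * (1 / 2) ≤ Nat.log 2 n * Real.log 2 := by gcongr
  rw [wordLength]
  push_cast
  linarith

theorem one_sub_pow_le_div {δ : ℝ} {k l : ℕ} (hδ₀ : 0 < δ) (hδ : δ ≤ 1) (hk : 1 ≤ k)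
    (hl : Real.log (k / δ) / δ ≤ l) : (1 - δ) ^ l ≤ δ / k := by
  have hkR : (0 : ℝ) < k := by exact_mod_cast hk
  rw [div_le_iff₀ hδ₀] at hl
  calc (1 - δ) ^ l ≤ Real.exp (-δ) ^ l := by
        refine pow_le_pow_left₀ (by linarith) ?_ l
        linarith [Real.add_one_le_exp (-δ)]
    _ = Real.exp (-(l * δ)) := by rw [← Real.exp_nat_mul]; ring_nf
    _ ≤ Real.exp (-Real.log (k / δ)) := by gcongr
    _ = δ / k := by
        rw [Real.exp_neg, Real.exp_log (by positivity), inv_div]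

/-- The error `δ = ε / 4` of the thresholds fits into the gap between `1 - 1/e - ε` and
`(1 - 1/e) (1 - ε)`. -/
theorem approx_factor_le {ε : ℝ} (hε : 0 < ε) (hε1 : ε < 1) :
    1 - 1 / Real.exp 1 - ε ≤ (1 - Real.exp (-(1 - ε / 4))) * (1 - ε) := by
  have he : Real.exp 1 < 4 := by linarith [Real.exp_one_lt_d9]
  have he2 : 2 < Real.exp 1 := by linarith [Real.exp_one_gt_d9]
  set x : ℝ := 1 / Real.exp 1 with hx
  have hx1 : 1 / 4 < x := one_div_lt_one_div_of_lt (by positivity) he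
  have hx2 : x < 1 / 2 := one_div_lt_one_div_of_lt (by norm_num) he2
  have h1 : Real.exp (-(1 - ε / 4)) = x * Real.exp (ε / 4) := by
    rw [hx, one_div, ← Real.exp_neg, ← Real.exp_add]
    ring_nf
  have h2 : Real.exp (ε / 4) ≤ 1 + ε / 2 := by
    have h := Real.add_one_le_exp (-(ε / 4))
    rw [Real.exp_neg] at h
    have h3 : Real.exp (ε / 4) * (-(ε / 4) + 1) ≤ 1 := by
      calc _ ≤ Real.exp (ε / 4) * (Real.exp (ε / 4))⁻¹ := by gcongr
        _ = 1 := mul_inv_cancel₀ (Real.exp_pos _).ne'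
    nlinarith [Real.exp_pos (ε / 4)]
  have h3 : x * Real.exp (ε / 4) ≤ x + ε / 4 := by
    calc x * Real.exp (ε / 4) ≤ x * (1 + ε / 2) := by gcongr
      _ ≤ x + ε / 4 := by nlinarith
  rw [h1]
  calc 1 - x - ε ≤ (1 - (x + ε / 4)) * (1 - ε) := by nlinarith
    _ ≤ _ := by gcongr

/-- The number of thresholds after which the threshold has dropped by the factor `δ / k`, where
`δ = ε / 4`. -/
noncomputable def numThresholds (k : ℕ) (ε : ℝ) : ℕ := ⌈Real.log (k / (ε / 4)) / (ε / 4)⌉₊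

/-- The bound uses that `log (k f / ε)` is bounded away from zero, as `ε < 1 - 1/e`. -/
theorem rounds_le {k f : ℕ} {ε : ℝ} (hk : 1 ≤ k) (hf : 1 ≤ f) (hε : 0 < ε)
    (hε1 : ε < 1 - 1 / Real.exp 1) :
    (((f + 1) * numThresholds k ε + 3 : ℕ) : ℝ) ≤
      500 * ((f : ℝ) ^ 3 / ε ^ 6 * Real.log ((k : ℝ) * f / ε) ^ 2) := by
  have hkR : (1 : ℝ) ≤ k := by exact_mod_cast hk
  have hfR : (1 : ℝ) ≤ f := by exact_mod_cast hf
  have he : Real.exp 1 < 4 := by linarith [Real.exp_one_lt_d9]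
  have hx1 : 1 / 4 < 1 / Real.exp 1 := one_div_lt_one_div_of_lt (by positivity) he
  have hεlt : ε ≤ 3 / 4 := by linarith
  set y : ℝ := Real.log ((k : ℝ) * f / ε) with hy
  have hkf : (1 : ℝ) ≤ k * f := one_le_mul_of_one_le_of_one_le hkR hfR
  have hy1 : 1 / 4 ≤ y := by
    have h1 : (4 / 3 : ℝ) ≤ k * f / ε := by
      rw [le_div_iff₀ hε]
      linarith
    have h2 := Real.log_le_log (by norm_num) h1
    have h3 := Real.one_sub_inv_le_log_of_pos (show (0 : ℝ) < 4 / 3 by norm_num)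
    norm_num at h3
    linarith
  have hlog : Real.log (k / (ε / 4)) ≤ 13 * y := by
    have h1 : (k : ℝ) / (ε / 4) ≤ 4 * (k * f / ε) := by
      have : (k : ℝ) / (ε / 4) = 4 * (k * 1 / ε) := by field_simp
      rw [this]
      gcongr
    have h2 := Real.log_le_log (by positivity) h1
    rw [Real.log_mul (by norm_num) (by positivity)] at h2
    have h3 := Real.log_le_sub_one_of_pos (show (0 : ℝ) < 4 by norm_num)
    linarith
  have hεinv : 1 ≤ 1 / ε := by rw [le_div_iff₀ hε]; linarith
  have hT : (numThresholds k ε : ℝ) ≤ 56 * (y / ε) := by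
    have h0 : 0 ≤ Real.log (k / (ε / 4)) / (ε / 4) := by
      refine div_nonneg (Real.log_nonneg ?_) (by positivity)
      rw [le_div_iff₀ (by positivity)]
      linarith
    have h1 := (Nat.ceil_lt_add_one h0).le
    have h2 : Real.log (k / (ε / 4)) / (ε / 4) ≤ 52 * (y / ε) := by
      calc _ ≤ 13 * y / (ε / 4) := by gcongr
        _ = _ := by field_simp; ring
    have h3 : 1 ≤ 4 * (y / ε) := by
      rw [div_eq_mul_one_div]
      nlinarith
    rw [numThresholds]
    linarith
  have hyε : 1 / 4 ≤ y / ε := by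
    rw [div_eq_mul_one_div y]
    nlinarith
  have hfy : 1 / 4 ≤ f * (y / ε) := by nlinarith
  calc (((f + 1) * numThresholds k ε + 3 : ℕ) : ℝ) = (f + 1) * numThresholds k ε + 3 := by
        push_cast; ring
    _ ≤ (f + f) * (56 * (y / ε)) + 12 * (f * (y / ε)) := by
        gcongr
        linarith
    _ = 124 * (f * (y * (1 / ε))) := by ring
    _ ≤ 124 * ((f : ℝ) ^ 3 * ((4 * y ^ 2) * (1 / ε) ^ 6)) := by
        gcongr
        · exact le_self_pow₀ hfR (by norm_num)
        · nlinarith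
        · exact le_self_pow₀ hεinv (by norm_num)
    _ = 496 * ((f : ℝ) ^ 3 / ε ^ 6 * y ^ 2) := by field_simp; ring
    _ ≤ 500 * ((f : ℝ) ^ 3 / ε ^ 6 * y ^ 2) := by
        gcongr
        norm_num

theorem card_le_optCoverage {n m : ℕ} (S : Fin m → Finset (Fin n)) {k : ℕ} (hk : 1 ≤ k)
    (hkm : k ≤ m) : (Finset.univ.sup fun j => (S j).card) ≤ optCoverage S k := by
  refine Finset.sup_le fun j _ => ?_
  have h := coverage_le_optCoverage S hkm (Z := {j}) (by simpa using hk)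
  simpa [coverage] using h

theorem coverage_mono {n m : ℕ} (S : Fin m → Finset (Fin n)) {T T' : Finset (Fin m)}
    (h : T ⊆ T') : coverage S T ≤ coverage S T' :=
  Finset.card_le_card (Finset.biUnion_subset_biUnion_of_subset_left S h)

/-- The parameters of threshold greedy for given `k`, `f` and `ε`. -/
noncomputable def greedyParams (k f : ℕ) (ε : ℝ) : GreedyParams where
  k := k
  N := ⌈(k : ℝ) * f / ε⌉₊
  q := f + 1
  δ := ε / 4

section Guarantee

variable {n m k f : ℕ} {ε : ℝ} (S : Fin m → Finset (Fin n))

theorem batchOf_lt (hf : maxFrequency S = f) (j : Fin m) :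
    batchOf n (fun j => (S j).card) j < f + 1 :=
  Nat.lt_succ_of_le (batchOf_le _ (hf ▸ sum_card_le S) j)

/-- The collection picked by threshold greedy is within the claimed factor of the optimum. -/
theorem coverage_greedyParams (hk : 1 ≤ k) (hkm : k ≤ m) (hf1 : 1 ≤ f)
    (hε : 0 < ε) (hε1 : ε < 1 - 1 / Real.exp 1) (hf : maxFrequency S = f) :
    (1 - 1 / Real.exp 1 - ε) * (optCoverage S k : ℝ) ≤
      coverage S ((greedyParams k f ε).greedy S ((f + 1) * numThresholds k ε)).1 := by
  have hepos : 0 < 1 / Real.exp 1 := by positivity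
  have hkR : (0 : ℝ) < k := by exact_mod_cast hk
  have he : Real.exp 1 < 4 := by linarith [Real.exp_one_lt_d9]
  have hx1 : 1 / 4 < 1 / Real.exp 1 := one_div_lt_one_div_of_lt (by positivity) he
  have hO : (0 : ℝ) ≤ optCoverage S k := Nat.cast_nonneg _
  have hL := (greedyParams k f ε).isLargest_largest S
  obtain ⟨X, hXL, hXk, hX⟩ := IsLargest.exists_coverage_ge (S := S) (k := k) (ε := ε) hε hk hkm
    (by rw [hf]; exact hf1) (L := (greedyParams k f ε).largest fun j => (S j).card)
    (by rw [hf]; exact hL)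
  rcases GreedyParams.coverage_greedy (P := greedyParams k f ε) (S := S) (X := X)
      (show (0 : ℝ) ≤ ε / 4 by linarith) (show ε / 4 ≤ 1 by linarith) hk
      (batchOf_lt S hf) hXL hXk (numThresholds k ε) with h | h
  · refine le_trans ?_ h
    calc (1 - 1 / Real.exp 1 - ε) * (optCoverage S k : ℝ)
        ≤ (1 - Real.exp (-(1 - ε / 4))) * (1 - ε) * optCoverage S k := by
          gcongr
          exact approx_factor_le hε (by linarith)
      _ = (1 - Real.exp (-(1 - ε / 4))) * ((1 - ε) * optCoverage S k) := by ring
      _ ≤ (1 - Real.exp (-(1 - ε / 4))) * coverage S X := by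
          refine mul_le_mul_of_nonneg_left hX ?_
          rw [sub_nonneg, Real.exp_le_one_iff]
          linarith
  · have hpow : (1 - ε / 4) ^ numThresholds k ε ≤ ε / 4 / k :=
      one_sub_pow_le_div (by linarith) (by linarith) hk (Nat.le_ceil _)
    have hM : ((Finset.univ.sup fun j => (S j).card : ℕ) : ℝ) ≤ optCoverage S k := by
      exact_mod_cast card_le_optCoverage S hk hkm
    have hsmall : (k : ℝ) * ((Finset.univ.sup fun j => (S j).card : ℕ) *
        (1 - ε / 4) ^ numThresholds k ε) ≤ ε / 4 * optCoverage S k := by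
      calc _ ≤ (k : ℝ) * (optCoverage S k * (ε / 4 / k)) := by
            gcongr
            exact pow_nonneg (by linarith) _
        _ = _ := by field_simp
    have h' : (coverage S X : ℝ) ≤
        coverage S ((greedyParams k f ε).greedy S ((f + 1) * numThresholds k ε)).1 +
          k * ((Finset.univ.sup fun j => (S j).card : ℕ) * (1 - ε / 4) ^ numThresholds k ε) := h
    nlinarith

end Guarantee

theorem mainTheorem8 (c : ℕ) :
    ∃ (C : ℝ) (a t₀ : ℕ), ∀ (n m k f : ℕ) (ε : ℝ),
      1 ≤ k → k ≤ m → m ≤ n → 1 ≤ f → 0 < ε → ε < 1 - 1 / Real.exp 1 →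
      ∃ A : MPCAlgorithm m,
        (A.rounds : ℝ) ≤ C * ((f : ℝ) ^ 3 / ε ^ 6 * Real.log ((k : ℝ) * f / ε) ^ 2) ∧
        ∀ S : Fin m → Finset (Fin n), maxFrequency S = f →
          A.SpaceBounded (setInput S) (C * (n * (1 + Real.log n) ^ a)) ∧
          (∃ L : Finset (Fin m), IsLargest S ⌈(k : ℝ) * f / ε⌉₊ L ∧
            A.RestrictsTo (setInput S) L t₀ ∧
            ∀ ω : A.Outcome, A.result (setInput S) ω ⊆ L ∧ (A.result (setInput S) ω).card = k) ∧
          1 - 1 / (m : ℝ) ^ c ≤ A.prob (fun ω =>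
            (1 - 1 / Real.exp 1 - ε) * (optCoverage S k : ℝ) ≤
              (coverage S (A.result (setInput S) ω) : ℝ)) := by
  refine ⟨500, 1, 1, fun n m k f ε hk hkm hmn hf1 hε hε1 => ?_⟩
  have hn : 1 ≤ n := by omega
  set P := greedyParams k f ε with hP
  set z : Fin m := ⟨0, by omega⟩
  set l := numThresholds k ε
  refine ⟨P.algorithm n z l, rounds_le hk hf1 hε hε1, fun S hf => ?_⟩
  have hlog : 0 ≤ Real.log n := Real.log_nonneg (by exact_mod_cast hn)
  have hL : IsLargest S ⌈(k : ℝ) * f / ε⌉₊ (P.largest (GreedyParams.sizes S)) :=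
    P.isLargest_largest S
  have hkL : k ≤ (P.largest (GreedyParams.sizes S)).card := by
    rw [hL.1]
    refine le_min ?_ hkm
    have hkR : (1 : ℝ) ≤ k := by exact_mod_cast hk
    have hfR : (1 : ℝ) ≤ f := by exact_mod_cast hf1
    have hepos : 0 < 1 / Real.exp 1 := by positivity
    have h1 : (k : ℝ) ≤ k * f / ε := by
      rw [le_div_iff₀ hε]
      nlinarith
    exact_mod_cast h1.trans (Nat.le_ceil _)
  -- Only the part of the invariant about the picked sets is used, so any `X` will do.
  have hinv := GreedyParams.greedyInv_greedy (P := P) (S := S) (X := ∅)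
    (show (0 : ℝ) ≤ ε / 4 by linarith)
    (show ε / 4 ≤ 1 by linarith [show 0 < 1 / Real.exp 1 by positivity]) hk
    (batchOf_lt S hf) (Finset.empty_subset _) (by simp) l
  have hfill := GreedyParams.card_fillUp hinv.subset hinv.card_le hkL
  refine ⟨⟨?_, fun ω t ht j => ?_⟩, ⟨_, hL, P.restrictsTo_algorithm S z l, fun ω => ?_⟩, ?_⟩
  · have : (P.algorithm n z l).coins = 0 := rfl
    rw [this, Nat.cast_zero]
    positivity
  · have h := P.space_algorithm S z l ω hn hmn ht j
    calc _ ≤ ((6 * (n * wordLength n) : ℕ) : ℝ) := by exact_mod_cast h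
      _ = 6 * (n * (wordLength n : ℝ)) := by push_cast; ring
      _ ≤ 6 * (n * (2 * (1 + Real.log n))) := by
          gcongr
          exact wordLength_le hn
      _ = 12 * (n * (1 + Real.log n) ^ 1) := by ring
      _ ≤ 500 * (n * (1 + Real.log n) ^ 1) := by
          gcongr
          norm_num
  · rw [P.result_algorithm]
    exact hfill.2
  · -- There are no coins, and the guarantee holds for every outcome.
    have hall : ∀ ω : (P.algorithm n z l).Outcome,
        (1 - 1 / Real.exp 1 - ε) * (optCoverage S k : ℝ) ≤
          (coverage S ((P.algorithm n z l).result (setInput S) ω) : ℝ) := by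
      intro ω
      rw [P.result_algorithm]
      refine (coverage_greedyParams S hk hkm hf1 hε hε1 hf).trans ?_
      exact_mod_cast coverage_mono S hfill.1
    have hprob : (P.algorithm n z l).prob (fun ω =>
        (1 - 1 / Real.exp 1 - ε) * (optCoverage S k : ℝ) ≤
          (coverage S ((P.algorithm n z l).result (setInput S) ω) : ℝ)) = 1 := by
      rw [MPCAlgorithm.prob, Nat.card_congr (Equiv.subtypeUnivEquiv hall)]
      exact div_self (Nat.cast_ne_zero.2 Nat.card_pos.ne')
    rw [hprob]
    have : 0 ≤ 1 / (m : ℝ) ^ c := by positivity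
    linarith
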